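/- For $E_0>0$ and $2<k<7/2$ let $\phi(E):=(E_0-E)_+^k$, where $(\cdot)_+$ denotes the positive part. By a Newtonian steady state for $\phi$ we mean a spherically symmetric function $U_N\in C^2(\mathbb{R}^3)$, written $U_N(x)=U_N(|x|)$, with $U_N(0)=0$ and $$\Delta U_N = 4\pi\rho_N,\qquad \rho_N(x)=\int_{\mathbb{R}^3}\phi\Big(\tfrac12|v|^2+U_N(x)\Big)\,dv ,$$ such that $\rho_N\in C^2(\mathbb{R}^3)$ and, for some $R_N>0$, the support of $\rho_N$ is the closed ball $\overline{B}_{R_N}(0)$, $U_N(R_N)=E_0$, $U_N(r)<E_0$ for $0\le r<R_N$, and $U_N(r)>E_0$ for $r>R_N$. Put $$a_N(r):=\int_{\mathbb{R}^3}\phi'\Big(\tfrac12|v|^2+U_N(r)\Big)\,dv,\qquad r\ge 0 .$$ **Lemma 7.1.** If $k<7/2$ is sufficiently close to $7/2$, then condition $(\phi 3)$ holds. That is, there exists $k_0\in[2,7/2)$ such that for all $k\in(k_0,7/2)$, all $E_0>0$ and every Newtonian steady state $U_N$ for $\phi(E)=(E_0-E)_+^k$, the integral defining $a_N(r)$ converges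 absolutely and $$6+4\pi r^2a_N(r)>0\qquad\text{for all } r\in[0,\infty).$$ -/

import Mathlib

/-- Euclidean three-space, with the Euclidean norm and Lebesgue measure. -/
abbrev E3 : Type := EuclideanSpace ℝ (Fin 3)

/-- The polytropic ansatz function `φ(E) = (E₀ - E)₊ ^ k`. -/
noncomputable def polytrope (E₀ k : ℝ) (E : ℝ) : ℝ := (max (E₀ - E) 0) ^ k

/-- The spherically symmetric potential `x ↦ u(|x|)` on three-space with radial profile `u`;
only the values of `u` on `[0, ∞)` matter. -/
noncomputable def radialPotential (u : ℝ → ℝ) (x : E3) : ℝ := u ‖x‖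

/-- The spatial density `ρ(x) = ∫ φ(|v|²/2 + U(x)) dv` induced by the ansatz
`f(x, v) = φ(|v|²/2 + U(x))`. -/
noncomputable def massDensity (φ : ℝ → ℝ) (U : E3 → ℝ) (x : E3) : ℝ :=
  ∫ v : E3, φ (‖v‖ ^ 2 / 2 + U x)

/-- The ansatz `f(x, v) = φ(|v|²/2 + U(x))`, with `U(x) = u(|x|)`, is a compactly supported,
spherically symmetric steady state of the Vlasov-Poisson system with cut-off energy `E₀` and
radius `R`, normalized by `U(0) = 0`. -/
structure IsNewtonianSteadyState (φ : ℝ → ℝ) (E₀ R : ℝ) (u : ℝ → ℝ) : Prop where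
  radius_pos : 0 < R
  contDiff_potential : ContDiff ℝ 2 (radialPotential u)
  poisson : ∀ x : E3, Laplacian.laplacian (radialPotential u) x =
    4 * Real.pi * massDensity φ (radialPotential u) x
  potential_zero : u 0 = 0
  contDiff_density : ContDiff ℝ 2 (massDensity φ (radialPotential u))
  tsupport_density : tsupport (massDensity φ (radialPotential u)) = Metric.closedBall 0 R
  potential_at_radius : u R = E₀
  potential_inside : ∀ r, 0 ≤ r → r < R → u r < E₀
  potential_outside : ∀ r, R < r → E₀ < u r

/-- The function `a_N(r) = ∫ φ'(|v|²/2 + U_N(r)) dv`. -/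
noncomputable def aN (φ : ℝ → ℝ) (u : ℝ → ℝ) (r : ℝ) : ℝ :=
  ∫ v : E3, deriv φ (‖v‖ ^ 2 / 2 + u r)

/-- The condition `6 + 4π r² a_N(r) > 0` for all `r ≥ 0`, including the convergence of the
integral that defines `a_N(r)`. -/
def StabilityCondition (φ : ℝ → ℝ) (u : ℝ → ℝ) : Prop :=
  ∀ r : ℝ, 0 ≤ r →
    MeasureTheory.Integrable (fun v : E3 => deriv φ (‖v‖ ^ 2 / 2 + u r)) ∧
      0 < 6 + 4 * Real.pi * r ^ 2 * aN φ u r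

open Set Filter Topology MeasureTheory


/-! With `w = E₀ - U` and `n = k + 3/2`, the steady state satisfies the Lane-Emden equation inside
its support, and `4π r² a_N = -n Q` with `Q = κ r² w ^ (n - 1)`; outside, `a_N` vanishes. So `n Q <
6` is needed. At an interior maximum of `Q` the slope `-r w' / w` equals `b = 2 / (n - 1)`. Two
Pohozaev functionals bound `Q` there. The one with parameter 3 is nonnegative for `n ≤ 5`, which
makes the slope increasing (`monotoneOn_logSlope`). Hence the slope is at most `b` up to the
maximum, and this forces the one with parameter 2 to be nonpositive (`pohozaev_two_nonpos`). At the
maximum that sign reads `Q ≤ 3b - 2b² ≤ 9/8`, and `5 · 9/8 < 6`. -/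

/-! ### Pohozaev estimates for the Lane-Emden equation -/

/-- `w` is a positive solution on `(0, R)`, vanishing at `R`, of the Lane-Emden equation
`w'' + 2 w' / r = -κ w ^ n`, with derivative `w'`, which is regular at the origin. -/
structure IsLaneEmdenSolution (κ n R : ℝ) (w w' : ℝ → ℝ) : Prop where
  radius_pos : 0 < R
  coeff_nonneg : 0 ≤ κ
  hasDerivAt : ∀ r, HasDerivAt w (w' r) r
  continuous_deriv : Continuous w'
  hasDerivAt_deriv : ∀ r ∈ Ioo 0 R, HasDerivAt w' (-(2 / r) * w' r - κ * w r ^ n) r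
  pos : ∀ r ∈ Ico 0 R, 0 < w r
  eq_zero : w R = 0

/-- The Pohozaev-type functional associated with the Lane-Emden equation. -/
noncomputable def pohozaev (κ n α : ℝ) (w w' : ℝ → ℝ) (r : ℝ) : ℝ :=
  κ * r ^ 3 * w r ^ (n + 1) + α * r ^ 3 * w' r ^ 2 + 3 * r ^ 2 * w r * w' r

namespace IsLaneEmdenSolution

variable {κ n R : ℝ} {w w' : ℝ → ℝ}

lemma continuous (h : IsLaneEmdenSolution κ n R w w') : Continuous w :=
  continuous_iff_continuousAt.2 fun r => (h.hasDerivAt r).continuousAt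

/-- The equation in divergence form is `(r² w')' = -κ r² w ^ n ≤ 0`, and `r² w'` vanishes at the
origin. -/
lemma deriv_nonpos (h : IsLaneEmdenSolution κ n R w w') {r : ℝ} (hr : r ∈ Ioo 0 R) :
    w' r ≤ 0 := by
  have hanti : AntitoneOn (fun r => r ^ 2 * w' r) (Icc 0 R) := by
    have hc := h.continuous_deriv
    refine antitoneOn_of_hasDerivWithinAt_nonpos (f' := fun r => -(κ * r ^ 2 * w r ^ n))
      (convex_Icc 0 R) (by fun_prop) ?_ ?_
    · intro s hs
      rw [interior_Icc] at hs
      have hs0 : s ≠ 0 := hs.1.ne'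
      refine ((((hasDerivAt_id s).pow 2).mul
        (h.hasDerivAt_deriv s hs)).congr_deriv ?_).hasDerivWithinAt
      simp only [id, Pi.pow_apply]
      field_simp
      push_cast
      ring
    · intro s hs
      rw [interior_Icc] at hs
      have := h.pos s ⟨hs.1.le, hs.2⟩
      have := h.coeff_nonneg
      simp only [Left.neg_nonpos_iff]
      positivity
  have := hanti (left_mem_Icc.2 h.radius_pos.le) ⟨hr.1.le, hr.2.le⟩ hr.1.le
  have h2 : 0 < r ^ 2 := pow_pos hr.1 2
  simp only at this
  nlinarith

lemma continuous_pohozaev (h : IsLaneEmdenSolution κ n R w w') (hn : 0 ≤ n + 1) (α : ℝ) :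
    Continuous (pohozaev κ n α w w') := by
  have h1 := h.continuous
  have h2 := h.continuous_deriv
  have h3 : Continuous fun r => w r ^ (n + 1) := h1.rpow_const fun _ => Or.inr hn
  unfold pohozaev
  fun_prop

lemma hasDerivAt_pohozaev (h : IsLaneEmdenSolution κ n R w w') (α : ℝ) {r : ℝ}
    (hr : r ∈ Ioo 0 R) :
    HasDerivAt (pohozaev κ n α w w')
      (r ^ 2 * w' r * ((n + 1 - 2 * α) * (κ * r * w r ^ n) + (3 - α) * w' r)) r := by
  have hw := h.pos r ⟨hr.1.le, hr.2⟩
  have hr0 : r ≠ 0 := hr.1.ne'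
  have d0 := h.hasDerivAt r
  have d1 := h.hasDerivAt_deriv r hr
  have dp := d0.rpow_const (p := n + 1) (Or.inl hw.ne')
  have e : w r ^ (n + 1) = w r ^ n * w r := Real.rpow_add_one hw.ne' n
  refine (((((hasDerivAt_id r).pow 3).const_mul κ).mul dp).add
    ((((hasDerivAt_id r).pow 3).const_mul α).mul (d1.pow 2))).add
    (((((hasDerivAt_id r).pow 2).const_mul 3).mul d0).mul d1) |>.congr_deriv ?_
  simp only [id, Pi.pow_apply, Pi.mul_apply, add_sub_cancel_right, e]
  field_simp
  ring

/-- Parameter 3 removes the `w'` term from the bracket in the derivative; what remains has the sign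
of `(n - 5) w' ≥ 0`, and the functional starts at 0. -/
lemma pohozaev_three_nonneg (h : IsLaneEmdenSolution κ n R w w') (hn : 0 ≤ n) (hn5 : n ≤ 5)
    {r : ℝ} (hr : r ∈ Ioo 0 R) : 0 ≤ pohozaev κ n 3 w w' r := by
  have hmono : MonotoneOn (pohozaev κ n 3 w w') (Icc 0 R) := by
    refine monotoneOn_of_hasDerivWithinAt_nonneg (convex_Icc 0 R)
      (h.continuous_pohozaev (by linarith) 3).continuousOn
      (fun s hs => (h.hasDerivAt_pohozaev 3 (by rwa [interior_Icc] at hs)).hasDerivWithinAt) ?_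
    intro s hs
    rw [interior_Icc] at hs
    have h1 := h.pos s ⟨hs.1.le, hs.2⟩
    have h2 := h.deriv_nonpos hs
    have h3 : 0 ≤ κ * s * w s ^ n := mul_nonneg (mul_nonneg h.coeff_nonneg hs.1.le) (by positivity)
    refine mul_nonneg_of_nonpos_of_nonpos (mul_nonpos_of_nonneg_of_nonpos (sq_nonneg s) h2) ?_
    nlinarith
  have := hmono (left_mem_Icc.2 h.radius_pos.le) ⟨hr.1.le, hr.2.le⟩ hr.1.le
  simpa [pohozaev] using this

/-- The bound `pohozaev_three_nonneg` after division by `r ^ 2`. -/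
lemma three_mul_le (h : IsLaneEmdenSolution κ n R w w') (hn : 0 ≤ n) (hn5 : n ≤ 5)
    {r : ℝ} (hr : r ∈ Ioo 0 R) :
    0 ≤ κ * r * w r ^ n * w r + 3 * r * w' r ^ 2 + 3 * w r * w' r := by
  have hp := h.pohozaev_three_nonneg hn hn5 hr
  have hw := h.pos r ⟨hr.1.le, hr.2⟩
  have e : w r ^ (n + 1) = w r ^ n * w r := Real.rpow_add_one hw.ne' n
  rw [pohozaev, e] at hp
  refine nonneg_of_mul_nonneg_right (a := r ^ 2) ?_ (pow_pos hr.1 2)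
  linarith

/-- The logarithmic slope `-r w' / w` increases. -/
lemma monotoneOn_logSlope (h : IsLaneEmdenSolution κ n R w w') (hn : 0 ≤ n) (hn5 : n ≤ 5) :
    MonotoneOn (fun r => -r * w' r / w r) (Ioo 0 R) := by
  have hd : ∀ s ∈ Ioo 0 R, HasDerivAt (fun r => -r * w' r / w r)
      ((κ * s * w s ^ n * w s + s * w' s ^ 2 + w s * w' s) / w s ^ 2) s := by
    intro s hs
    have hw := (h.pos s ⟨hs.1.le, hs.2⟩).ne'
    have hs0 : s ≠ 0 := hs.1.ne'
    refine (((hasDerivAt_id s).neg.mul (h.hasDerivAt_deriv s hs)).div (h.hasDerivAt s) hw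
      ).congr_deriv ?_
    simp only [id, Pi.neg_apply, Pi.mul_apply]
    field_simp
    ring
  refine monotoneOn_of_hasDerivWithinAt_nonneg (convex_Ioo 0 R)
    (fun s hs => (hd s hs).continuousAt.continuousWithinAt)
    (fun s hs => (hd s (by rwa [interior_Ioo] at hs)).hasDerivWithinAt) ?_
  intro s hs
  rw [interior_Ioo] at hs
  have h1 := h.pos s ⟨hs.1.le, hs.2⟩
  have h2 := h.three_mul_le hn hn5 hs
  have h3 : 0 ≤ κ * s * w s ^ n * w s :=
    mul_nonneg (mul_nonneg (mul_nonneg h.coeff_nonneg hs.1.le) (by positivity)) h1.le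
  refine div_nonneg ?_ (sq_nonneg _)
  -- Three times the numerator is the nonnegative expression `h2` plus twice `h3`.
  linarith

/-- As long as `-r w' / w` has not exceeded `2 / (n - 1)`, the functional `pohozaev` with
parameter `2` is nonpositive. -/
lemma pohozaev_two_nonpos (h : IsLaneEmdenSolution κ n R w w') (hn : 9 / 2 ≤ n) (hn5 : n ≤ 5)
    {r : ℝ} (hr : r ∈ Ioo 0 R) (hv : -r * w' r / w r ≤ 2 / (n - 1)) :
    pohozaev κ n 2 w w' r ≤ 0 := by
  have hanti : AntitoneOn (pohozaev κ n 2 w w') (Icc 0 r) := by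
    refine antitoneOn_of_hasDerivWithinAt_nonpos (convex_Icc 0 r)
      (h.continuous_pohozaev (by linarith) 2).continuousOn
      (fun s hs => (h.hasDerivAt_pohozaev 2 ?_).hasDerivWithinAt) ?_
    · rw [interior_Icc] at hs
      exact ⟨hs.1, hs.2.trans hr.2⟩
    intro s hs
    rw [interior_Icc] at hs
    have hs' : s ∈ Ioo 0 R := ⟨hs.1, hs.2.trans hr.2⟩
    have h1 := h.pos s ⟨hs'.1.le, hs'.2⟩
    have h2 := h.deriv_nonpos hs'
    have h3 := h.three_mul_le (by linarith) hn5 hs'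
    -- `4/7` is the value of `2 / (n - 1)` at `n = 9/2`.
    have h4 : -s * w' s / w s ≤ 4 / 7 :=
      ((h.monotoneOn_logSlope (by linarith) hn5 hs' hr hs.2.le).trans hv).trans
        (by rw [div_le_div_iff₀] <;> linarith)
    rw [div_le_iff₀ h1] at h4
    have h5 : 0 ≤ κ * s * w s ^ n := mul_nonneg (mul_nonneg h.coeff_nonneg hs'.1.le) (by positivity)
    refine mul_nonpos_of_nonpos_of_nonneg (mul_nonpos_of_nonneg_of_nonpos (sq_nonneg s) h2) ?_
    -- By `h4`, `3 s w'² ≤ -(12/7) w w'`, and `3 - 12/7 = 9/7`.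
    have h6 : 0 ≤ (κ * s * w s ^ n + 9 / 7 * w' s) * w s := by nlinarith
    have h7 := nonneg_of_mul_nonneg_left h6 h1
    -- The bracket is `(n - 3) κ s w ^ n + w'`; here `n - 3 ≥ 3/2`, while `-w' ≤ (7/9) κ s w ^ n`.
    nlinarith
  have := hanti (left_mem_Icc.2 hr.1.le) (right_mem_Icc.2 hr.1.le) hr.1.le
  simpa [pohozaev] using this

/-- For exponents close to `5` from below, `n κ r² w ^ (n - 1)` stays below `6`. -/
theorem mul_sq_mul_rpow_lt (h : IsLaneEmdenSolution κ n R w w') (hn : 9 / 2 ≤ n) (hn5 : n < 5)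
    {r : ℝ} (hr : r ∈ Ioo 0 R) : n * (κ * r ^ 2 * w r ^ (n - 1)) < 6 := by
  set Q : ℝ → ℝ := fun r => κ * r ^ 2 * w r ^ (n - 1) with hQ
  rcases le_or_gt (Q r) 0 with h0 | h0
  · have : n * Q r ≤ 0 := mul_nonpos_of_nonneg_of_nonpos (by linarith) h0
    exact this.trans_lt (by norm_num)
  have hQc : Continuous Q := by
    have h1 := h.continuous
    have h3 : Continuous fun r => w r ^ (n - 1) := h1.rpow_const fun _ => Or.inr (by linarith)
    fun_prop
  obtain ⟨s, hs, hmax⟩ := isCompact_Icc.exists_isMaxOn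
    (nonempty_Icc.2 h.radius_pos.le) hQc.continuousOn
  have hrs : Q r ≤ Q s := hmax ⟨hr.1.le, hr.2.le⟩
  have hs0 : s ≠ 0 := by
    rintro rfl
    simp [hQ] at hrs h0
    linarith
  have hsR : s ≠ R := by
    rintro rfl
    simp only [hQ, h.eq_zero, Real.zero_rpow (show n - 1 ≠ 0 by linarith)] at hrs h0
    linarith
  have hs' : s ∈ Ioo 0 R := ⟨lt_of_le_of_ne hs.1 hs0.symm, lt_of_le_of_ne hs.2 hsR⟩
  have hw := h.pos s ⟨hs'.1.le, hs'.2⟩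
  have hloc : IsLocalMax Q s := hmax.isLocalMax (Icc_mem_nhds hs'.1 hs'.2)
  have e1 : w s ^ (n - 1) = w s ^ (n - 1 - 1) * w s := by
    rw [← Real.rpow_add_one hw.ne']; ring_nf
  have e2 : w s ^ (n + 1) = w s ^ (n - 1) * w s ^ 2 := by
    rw [← Real.rpow_natCast, ← Real.rpow_add hw]; norm_num; ring_nf
  have hκ : 0 < κ := by
    refine lt_of_le_of_ne h.coeff_nonneg ?_
    rintro rfl
    simp [hQ] at h0
  have hcrit : 2 * w s + (n - 1) * (s * w' s) = 0 := by
    have hd := ((((hasDerivAt_id s).pow 2).const_mul κ).mul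
      ((h.hasDerivAt s).rpow_const (p := n - 1) (Or.inl hw.ne')))
    have := hloc.hasDerivAt_eq_zero hd
    simp only [id, Pi.pow_apply, e1] at this
    have hpos : κ * s * w s ^ (n - 1 - 1) ≠ 0 :=
      mul_ne_zero (mul_ne_zero hκ.ne' hs0) (by positivity)
    refine (mul_eq_zero.1 (?_ : κ * s * w s ^ (n - 1 - 1) *
      (2 * w s + (n - 1) * (s * w' s)) = 0)).resolve_left hpos
    rw [← this]
    push_cast
    ring
  have hβ : s * w' s = -(2 / (n - 1)) * w s := by
    have : n - 1 ≠ 0 := by linarith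
    field_simp
    linarith
  have hP := h.pohozaev_two_nonpos hn hn5.le hs' (by
    rw [div_le_iff₀ hw]; linarith)
  set b := 2 / (n - 1)
  have hPb : s * w s ^ 2 * (Q s - (3 * b - 2 * b ^ 2)) ≤ 0 := by
    refine le_of_eq_of_le ?_ hP
    rw [pohozaev, e2]
    have : s * w s ^ 2 * (Q s - (3 * b - 2 * b ^ 2)) = κ * s ^ 3 * (w s ^ (n - 1) * w s ^ 2)
      + 2 * s * (-b * w s) ^ 2 + 3 * s * w s * (-b * w s) := by simp only [hQ]; ring
    rw [this, ← hβ]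
    ring
  have hQs : Q s ≤ 3 * b - 2 * b ^ 2 :=
    sub_nonpos.1 (nonpos_of_mul_nonpos_right hPb (mul_pos hs'.1 (by positivity)))
  -- `9/8` is the maximum of `3b - 2b²`, attained at `b = 3/4`.
  have : Q r ≤ 9 / 8 := hrs.trans (hQs.trans (by nlinarith [sq_nonneg (b - 3 / 4)]))
  change n * Q r < 6
  nlinarith

end IsLaneEmdenSolution


/-! ### The Laplacian of a radial function -/

/-- A second directional derivative of a `C²` function is computed along the line. -/
lemma iteratedFDeriv_two_eq_of_hasDerivAt {E : Type*} [NormedAddCommGroup E] [NormedSpace ℝ E]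
    {f : E → ℝ} (hf : ContDiff ℝ 2 f) {x v : E} {f₁ : ℝ → ℝ} {a : ℝ}
    (h₁ : ∀ᶠ t in 𝓝 (0 : ℝ), HasDerivAt (fun t : ℝ => f (x + t • v)) (f₁ t) t)
    (h₂ : HasDerivAt f₁ a 0) : iteratedFDeriv ℝ 2 f x ![v, v] = a := by
  have hline : ∀ t : ℝ, HasDerivAt (fun t : ℝ => x + t • v) v t := fun t => by
    simpa using ((hasDerivAt_id t).smul_const v).const_add x
  have hf1 : ∀ t : ℝ, HasDerivAt (fun t : ℝ => f (x + t • v)) (fderiv ℝ f (x + t • v) v) t :=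
    fun t => ((hf.differentiable (by norm_num)) (x + t • v)).hasFDerivAt.comp_hasDerivAt t (hline t)
  have heq : (fun t : ℝ => fderiv ℝ f (x + t • v) v) =ᶠ[𝓝 0] f₁ :=
    h₁.mono fun t ht => (hf1 t).unique ht
  have hdf : Differentiable ℝ (fderiv ℝ f) :=
    (hf.fderiv_right (m := 1) (by norm_num)).differentiable (by norm_num)
  have h3 : HasDerivAt (fun t : ℝ => fderiv ℝ f (x + t • v) v)
      (fderiv ℝ (fderiv ℝ f) (x + (0 : ℝ) • v) v v) 0 :=
    ((hdf _).hasFDerivAt.comp_hasDerivAt (0 : ℝ) (hline 0)).clm_apply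
      (hasDerivAt_const (0 : ℝ) v) |>.congr_deriv (by simp)
  rw [iteratedFDeriv_two_apply]
  have := h3.unique (h₂.congr_of_eventuallyEq heq)
  simpa using this

lemma norm_smul_single_add_smul_single (r t : ℝ) {i j : Fin 3} (hij : i ≠ j) :
    ‖(r • EuclideanSpace.single i (1 : ℝ) + t • EuclideanSpace.single j (1 : ℝ) : E3)‖ =
      √(r ^ 2 + t ^ 2) := by
  rw [EuclideanSpace.norm_eq]
  congr 1
  fin_cases i <;> fin_cases j <;> simp [Fin.sum_univ_three] at hij ⊢ <;> ring

/-- The even extension of the profile `u`. -/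
noncomputable def evenProfile (u : ℝ → ℝ) (r : ℝ) : ℝ := u |r|

lemma evenProfile_eq_radialPotential (u : ℝ → ℝ) (r : ℝ) :
    evenProfile u r = radialPotential u (r • EuclideanSpace.single (0 : Fin 3) (1 : ℝ)) := by
  simp [evenProfile, radialPotential, norm_smul]

/-- The even extension is the restriction of the potential to a line through the origin; `u` itself
is arbitrary on negative arguments. -/
lemma contDiff_evenProfile {u : ℝ → ℝ} (hu : ContDiff ℝ 2 (radialPotential u)) :
    ContDiff ℝ 2 (evenProfile u) := by
  rw [funext (evenProfile_eq_radialPotential u)]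
  exact hu.comp (contDiff_id.smul contDiff_const)

/-- The Laplacian of a radially symmetric function. -/
lemma laplacian_radialPotential {u : ℝ → ℝ} (hu : ContDiff ℝ 2 (radialPotential u)) {r : ℝ}
    (hr : 0 < r) :
    Laplacian.laplacian (radialPotential u) (r • EuclideanSpace.single (0 : Fin 3) (1 : ℝ)) =
      deriv (deriv (evenProfile u)) r + 2 / r * deriv (evenProfile u) r := by
  set g := evenProfile u
  have hg : ContDiff ℝ 2 g := contDiff_evenProfile hu
  have hg1 : ∀ s, HasDerivAt g (deriv g s) s := fun s =>
    (hg.differentiable (by norm_num) s).hasDerivAt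
  have hg2 : ∀ s, HasDerivAt (deriv g) (deriv (deriv g) s) s := fun s =>
    (((contDiff_succ_iff_deriv (n := 1)).1 hg).2.2.differentiable (by norm_num) s).hasDerivAt
  have h0 : iteratedFDeriv ℝ 2 (radialPotential u) (r • EuclideanSpace.single (0 : Fin 3) (1 : ℝ))
      ![EuclideanSpace.single 0 1, EuclideanSpace.single 0 1] = deriv (deriv g) r := by
    refine iteratedFDeriv_two_eq_of_hasDerivAt hu (f₁ := fun t => deriv g (r + t))
      (.of_forall fun t => ?_) ?_
    · simp_rw [← add_smul, ← evenProfile_eq_radialPotential]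
      exact (hg1 (r + t)).comp_const_add r t
    · exact HasDerivAt.comp_const_add r 0 (by simpa using hg2 r)
  have hi : ∀ i : Fin 3, 0 ≠ i → iteratedFDeriv ℝ 2 (radialPotential u)
      (r • EuclideanSpace.single (0 : Fin 3) (1 : ℝ))
      ![EuclideanSpace.single i 1, EuclideanSpace.single i 1] = deriv g r / r := by
    intro i hi
    -- Along a direction orthogonal to the base point, the norm is `√(r² + t²)`.
    have hs : ∀ t, HasDerivAt (fun t : ℝ => √(r ^ 2 + t ^ 2)) (t / √(r ^ 2 + t ^ 2)) t := by
      intro t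
      have := (((hasDerivAt_id t).pow 2).const_add (r ^ 2)).sqrt
        (by simp only [Pi.pow_apply, id]; positivity)
      refine this.congr_deriv ?_
      simp only [Pi.pow_apply, id]
      field_simp
      ring
    refine iteratedFDeriv_two_eq_of_hasDerivAt hu
      (f₁ := fun t => deriv g (√(r ^ 2 + t ^ 2)) * (t / √(r ^ 2 + t ^ 2)))
      (.of_forall fun t => ?_) ?_
    · have e : (fun t : ℝ => radialPotential u (r • EuclideanSpace.single (0 : Fin 3) (1 : ℝ) +
          t • EuclideanSpace.single i (1 : ℝ))) = fun t => g (√(r ^ 2 + t ^ 2)) := by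
        ext t
        simp only [radialPotential, norm_smul_single_add_smul_single r t hi, g, evenProfile,
          abs_of_nonneg (Real.sqrt_nonneg _)]
      rw [e]
      exact (hg1 _).comp t (hs t)
    · have e : √(r ^ 2 + (0 : ℝ) ^ 2) = r := by simp [Real.sqrt_sq hr.le]
      have d1 := (hg2 (√(r ^ 2 + (0 : ℝ) ^ 2))).comp (0 : ℝ) (hs 0)
      have d2 := (hasDerivAt_id (0 : ℝ)).div (hs 0) (by rw [e]; exact hr.ne')
      refine (d1.mul d2).congr_deriv ?_
      simp only [Function.comp, Pi.div_apply, id, e]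
      field_simp
      ring
  rw [InnerProductSpace.laplacian_eq_iteratedFDeriv_orthonormalBasis _
    (EuclideanSpace.basisFun (Fin 3) ℝ)]
  simp only [Fin.sum_univ_three, EuclideanSpace.basisFun_apply]
  rw [h0, hi 1 (by decide), hi 2 (by decide)]
  ring


/-! ### Velocity integrals of truncated powers -/

lemma hasDerivAt_max_zero_rpow {p : ℝ} (hp : 1 < p) (x : ℝ) :
    HasDerivAt (fun x : ℝ => max x 0 ^ p) (p * max x 0 ^ (p - 1)) x := by
  rcases lt_trichotomy x 0 with hx | rfl | hx
  · rw [max_eq_right hx.le, Real.zero_rpow (by linarith), mul_zero]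
    refine (hasDerivAt_const x (0 : ℝ)).congr_of_eventuallyEq ?_
    filter_upwards [Iio_mem_nhds hx] with y hy
    rw [max_eq_right (le_of_lt hy), Real.zero_rpow (by linarith)]
  · rw [max_self, Real.zero_rpow (by linarith), mul_zero, ← hasDerivWithinAt_univ,
      ← Iic_union_Ici (a := (0 : ℝ))]
    refine HasDerivWithinAt.union ?_ ?_
    · refine (hasDerivWithinAt_const (0 : ℝ) (Iic 0) (0 : ℝ)).congr ?_ ?_
      · intro y hy
        rw [max_eq_right hy, Real.zero_rpow (by linarith)]
      · rw [max_self, Real.zero_rpow (by linarith)]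
    · have h := (Real.hasDerivAt_rpow_const (x := 0) (p := p) (Or.inr hp.le)).hasDerivWithinAt
        (s := Ici 0)
      rw [Real.zero_rpow (by linarith), mul_zero] at h
      refine h.congr ?_ ?_
      · intro y hy
        simp only [max_eq_left (show (0 : ℝ) ≤ y from hy)]
      · rw [max_self]
  · rw [max_eq_left hx.le]
    refine (Real.hasDerivAt_rpow_const (p := p) (Or.inl hx.ne')).congr_of_eventuallyEq ?_
    filter_upwards [Ioi_mem_nhds hx] with y hy
    rw [max_eq_left (le_of_lt hy)]

lemma deriv_polytrope {E₀ k : ℝ} (hk : 1 < k) (E : ℝ) :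
    deriv (polytrope E₀ k) E = -(k * max (E₀ - E) 0 ^ (k - 1)) := by
  have := (hasDerivAt_max_zero_rpow hk (E₀ - E)).comp_const_sub E₀ E
  exact this.deriv

/-- The truncated power `(a - |v|²/2)₊ ^ p`, as a function of the velocity. -/
noncomputable def truncatedPower (a p : ℝ) (v : E3) : ℝ := max (a - ‖v‖ ^ 2 / 2) 0 ^ p

lemma integrable_truncatedPower (a : ℝ) {p : ℝ} (hp : 0 < p) : Integrable (truncatedPower a p) := by
  refine Continuous.integrable_of_hasCompactSupport ?_ ?_
  · unfold truncatedPower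
    refine Continuous.rpow_const (by fun_prop) fun _ => Or.inr hp.le
  · refine HasCompactSupport.intro (isCompact_closedBall (0 : E3) √(2 * a)) fun v hv => ?_
    rw [mem_closedBall_zero_iff, not_le] at hv
    have : 2 * a < ‖v‖ ^ 2 := Real.lt_sq_of_sqrt_lt hv
    rw [truncatedPower, max_eq_right (by linarith), Real.zero_rpow hp.ne']

/-- Substituting `√a • v` for `v` gives `a ^ p` from the integrand and `a ^ (3/2)` from the volume.
-/
lemma integral_truncatedPower {a p : ℝ} (ha : 0 < a) :
    ∫ v, truncatedPower a p v = a ^ (p + 3 / 2) * ∫ v, truncatedPower 1 p v := by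
  have hsa : 0 < √a := Real.sqrt_pos.2 ha
  have h := Measure.integral_comp_smul_of_nonneg (volume : Measure E3) (truncatedPower a p) √a
    (hR := hsa.le)
  have e : ∀ v : E3, truncatedPower a p (√a • v) = a ^ p * truncatedPower 1 p v := by
    intro v
    rw [truncatedPower, truncatedPower, norm_smul, Real.norm_of_nonneg hsa.le, mul_pow,
      Real.sq_sqrt ha.le, ← Real.mul_rpow ha.le (le_max_right _ _), mul_max_of_nonneg _ _ ha.le]
    congr 2 <;> ring
  simp_rw [e] at h
  rw [integral_const_mul, finrank_euclideanSpace, Fintype.card_fin, smul_eq_mul,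
    eq_inv_mul_iff_mul_eq₀ (by positivity)] at h
  rw [← h, ← mul_assoc, Real.rpow_add ha]
  congr 1
  rw [mul_comm]
  congr 1
  rw [Real.sqrt_eq_rpow, ← Real.rpow_natCast, ← Real.rpow_mul ha.le]
  norm_num

lemma integral_truncatedPower_of_nonpos {a p : ℝ} (ha : a ≤ 0) (hp : 0 < p) :
    ∫ v, truncatedPower a p v = 0 := by
  have : truncatedPower a p = fun _ => 0 := by
    ext v
    rw [truncatedPower, max_eq_right (by linarith [sq_nonneg ‖v‖]), Real.zero_rpow hp.ne']
  simp [this]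

lemma integral_truncatedPower_nonneg (a p : ℝ) : 0 ≤ ∫ v, truncatedPower a p v :=
  integral_nonneg fun _ => Real.rpow_nonneg (le_max_right _ _) _

lemma integral_radial_eq (f : ℝ → ℝ) :
    ∫ v : E3, f ‖v‖ =
      3 * ((volume : Measure E3).real (Metric.ball 0 1) * ∫ y in Ioi (0 : ℝ), y ^ 2 * f y) := by
  rw [integral_fun_norm_addHaar, finrank_euclideanSpace, Fintype.card_fin]
  simp

/-- Raising the exponent of `(1 - |v|²/2)₊` by one multiplies its integral by `k / (k + 3/2)`. -/
lemma mul_integral_truncatedPower_sub_one {k : ℝ} (hk : 1 < k) :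
    k * ∫ v, truncatedPower 1 (k - 1) v = (k + 3 / 2) * ∫ v, truncatedPower 1 k v := by
  set F : ℝ → ℝ → ℝ := fun p y => max (1 - y ^ 2 / 2) 0 ^ p with hF
  have hFc : ∀ p, 0 < p → Continuous (F p) := fun p hp =>
    Continuous.rpow_const (by fun_prop) fun _ => Or.inr hp.le
  have hF0 : ∀ p, 0 < p → ∀ y, 2 ≤ y → F p y = 0 := fun p hp y hy => by
    simp only [hF]
    rw [max_eq_right (by nlinarith), Real.zero_rpow hp.ne']
  have hFs : ∀ p, 0 < p → HasCompactSupport (F p) := fun p hp =>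
    HasCompactSupport.intro (isCompact_Icc (a := (-2 : ℝ)) (b := 2)) fun y hy => by
      have : 2 < |y| := by
        by_contra! hc
        exact hy (abs_le.1 hc)
      have h2 : F p y = F p |y| := by simp only [hF, sq_abs]
      rw [h2, hF0 p hp _ this.le]
  have hI : ∀ p, 0 < p → IntegrableOn (fun y => y ^ 2 * F p y) (Ioi 0) := fun p hp => by
    have hc := hFc p hp
    exact (Continuous.integrable_of_hasCompactSupport (by fun_prop)
      (hFs p hp).mul_left).integrableOn
  -- The recursion comes from integrating the derivative of `y³ (1 - y²/2)₊ ^ k`, whose boundary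
  -- values vanish.
  have hd : ∀ y, HasDerivAt (fun y => y ^ 3 * F k y)
      ((3 + 2 * k) * (y ^ 2 * F k y) - 2 * k * (y ^ 2 * F (k - 1) y)) y := by
    intro y
    have d1 : HasDerivAt (fun y : ℝ => 1 - y ^ 2 / 2) (-y) y := by
      refine ((((hasDerivAt_id y).pow 2).div_const 2).const_sub 1).congr_deriv ?_
      simp
    have d2 := (hasDerivAt_max_zero_rpow hk (1 - y ^ 2 / 2)).comp y d1
    refine (((hasDerivAt_id y).pow 3).mul d2).congr_deriv ?_
    have e : F k y = F (k - 1) y * (1 - y ^ 2 / 2) := by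
      simp only [hF]
      rcases le_or_gt (1 - y ^ 2 / 2) 0 with h | h
      · rw [max_eq_right h, Real.zero_rpow (by linarith), Real.zero_rpow (by linarith), zero_mul]
      · rw [max_eq_left h.le, ← Real.rpow_add_one h.ne', sub_add_cancel]
    simp only [id, Pi.pow_apply, Function.comp]
    change _ * F k y + _ * (k * F (k - 1) y * -y) = _
    rw [e]
    push_cast
    ring
  have key := integral_Ioi_of_hasDerivAt_of_tendsto' (a := 0) (m := 0) (fun y _ => hd y)
    (((hI k (by linarith)).const_mul _).sub ((hI (k - 1) (by linarith)).const_mul _))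
    (tendsto_const_nhds.congr' (by
      filter_upwards [eventually_ge_atTop 2] with y hy
      rw [hF0 k (by linarith) y hy, mul_zero]))
  rw [integral_sub ((hI k (by linarith)).const_mul _) ((hI (k - 1) (by linarith)).const_mul _),
    integral_const_mul, integral_const_mul] at key
  have hr : ∀ p, ∫ v, truncatedPower 1 p v = 3 * ((volume : Measure E3).real (Metric.ball 0 1) *
      ∫ y in Ioi (0 : ℝ), y ^ 2 * F p y) := fun p => integral_radial_eq (F p)
  rw [hr, hr]
  norm_num at key
  linear_combination (-3 / 2 * (volume : Measure E3).real (Metric.ball 0 1)) * key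


/-! ### From the steady state to Lane-Emden -/

lemma massDensity_polytrope_of_lt {E₀ k : ℝ} {U : E3 → ℝ} {x : E3} (hx : U x < E₀) :
    massDensity (polytrope E₀ k) U x =
      (∫ v, truncatedPower 1 k v) * (E₀ - U x) ^ (k + 3 / 2) := by
  rw [mul_comm, ← integral_truncatedPower (sub_pos.2 hx), massDensity]
  refine integral_congr_ae (.of_forall fun v => ?_)
  simp only [polytrope, truncatedPower]
  ring_nf

lemma deriv_polytrope_kinetic_add {E₀ k : ℝ} (hk : 1 < k) (e : ℝ) :
    (fun v : E3 => deriv (polytrope E₀ k) (‖v‖ ^ 2 / 2 + e)) =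
      fun v => -k * truncatedPower (E₀ - e) (k - 1) v := by
  ext v
  rw [deriv_polytrope hk, truncatedPower]
  ring_nf

lemma integrable_deriv_polytrope {E₀ k : ℝ} (hk : 1 < k) (e : ℝ) :
    Integrable fun v : E3 => deriv (polytrope E₀ k) (‖v‖ ^ 2 / 2 + e) := by
  rw [deriv_polytrope_kinetic_add hk]
  exact (integrable_truncatedPower _ (by linarith)).const_mul _

lemma aN_polytrope_of_le {E₀ k r : ℝ} {u : ℝ → ℝ} (hk : 1 < k) (hr : E₀ ≤ u r) :
    aN (polytrope E₀ k) u r = 0 := by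
  rw [aN, deriv_polytrope_kinetic_add hk, integral_const_mul,
    integral_truncatedPower_of_nonpos (by linarith) (by linarith), mul_zero]

/-- The exponent recursion expresses `a_N` through the same constant as the density, so that `n = k
+ 3/2` appears as a factor. -/
lemma aN_polytrope_of_lt {E₀ k r : ℝ} {u : ℝ → ℝ} (hk : 1 < k) (hr : u r < E₀) :
    aN (polytrope E₀ k) u r =
      -((k + 3 / 2) * ((∫ v, truncatedPower 1 k v) * (E₀ - u r) ^ (k + 3 / 2 - 1))) := by
  rw [aN, deriv_polytrope_kinetic_add hk, integral_const_mul,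
    integral_truncatedPower (sub_pos.2 hr), ← mul_assoc (k + 3 / 2),
    ← mul_integral_truncatedPower_sub_one hk, show k - 1 + 3 / 2 = k + 3 / 2 - 1 by ring]
  ring

/-- The function `E₀ - U` of a polytropic steady state solves the Lane-Emden equation. -/
lemma IsNewtonianSteadyState.isLaneEmdenSolution {E₀ k R : ℝ} {u : ℝ → ℝ}
    (h : IsNewtonianSteadyState (polytrope E₀ k) E₀ R u) :
    IsLaneEmdenSolution (4 * Real.pi * ∫ v, truncatedPower 1 k v) (k + 3 / 2) R
      (fun r => E₀ - evenProfile u r) (fun r => -deriv (evenProfile u) r) := by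
  have hg := contDiff_evenProfile h.contDiff_potential
  have hg1 : ContDiff ℝ 1 (deriv (evenProfile u)) :=
    ((contDiff_succ_iff_deriv (n := 1)).1 hg).2.2
  refine ⟨h.radius_pos, mul_nonneg (by positivity) (integral_truncatedPower_nonneg _ _),
    fun r => ((hg.differentiable (by norm_num) r).hasDerivAt).const_sub E₀, hg1.continuous.neg,
    fun r hr => ?_, fun r hr => ?_, ?_⟩
  · refine ((hg1.differentiable (by norm_num) r).hasDerivAt).neg.congr_deriv ?_
    have hp := h.poisson (r • EuclideanSpace.single (0 : Fin 3) (1 : ℝ))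
    have hlt : evenProfile u r < E₀ := by
      rw [evenProfile, abs_of_pos hr.1]
      exact h.potential_inside r hr.1.le hr.2
    rw [evenProfile_eq_radialPotential] at hlt
    rw [laplacian_radialPotential h.contDiff_potential hr.1,
      massDensity_polytrope_of_lt hlt, ← evenProfile_eq_radialPotential] at hp
    linear_combination -hp
  · rw [evenProfile, abs_of_nonneg hr.1]
    exact sub_pos.2 (h.potential_inside r hr.1 hr.2)
  · rw [evenProfile, abs_of_pos h.radius_pos, h.potential_at_radius, sub_self]

theorem lemma7p1 :
    ∃ k₀ : ℝ, 2 ≤ k₀ ∧ k₀ < 7 / 2 ∧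
      ∀ k : ℝ, k₀ < k → k < 7 / 2 →
        ∀ (E₀ R : ℝ) (u : ℝ → ℝ), 0 < E₀ →
          IsNewtonianSteadyState (polytrope E₀ k) E₀ R u →
            StabilityCondition (polytrope E₀ k) u := by
  -- `k > 3` gives `n > 9/2`, and `k < 7/2` gives `n < 5`.
  refine ⟨3, by norm_num, by norm_num, fun k hk hk' E₀ R u _ h r hr => ?_⟩
  refine ⟨integrable_deriv_polytrope (by linarith) _, ?_⟩
  rcases hr.eq_or_lt with rfl | hr0
  · norm_num
  rcases lt_or_ge r R with hrR | hrR
  · have := h.isLaneEmdenSolution.mul_sq_mul_rpow_lt (by linarith) (by linarith) ⟨hr0, hrR⟩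
    rw [evenProfile, abs_of_pos hr0] at this
    rw [aN_polytrope_of_lt (by linarith) (h.potential_inside r hr hrR)]
    linarith
  · have hE : E₀ ≤ u r := by
      rcases hrR.eq_or_lt with rfl | hlt
      · exact h.potential_at_radius.ge
      · exact (h.potential_outside r hlt).le
    rw [aN_polytrope_of_le (by linarith) hE]
    norm_num
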